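/- Let $n\ge 2$, $d>0$, let $A=\mathbf 1\mathbf 1^{\top}-I_n$ be the adjacency matrix of the complete graph on $n$ nodes, and consider the opinion dynamics $\dot x=\Phi(x,u):=-dx+uA\tanh(x)$ on $\mathbb R^n$ ($\tanh$ componentwise) with parameter $u\in\mathbb R$. Put $x^\star=0$, $u^\star=\frac{d}{n-1}$, $J^\star=D_x\Phi(x^\star,u^\star)$. Lyapunov–Schmidt bounds. Let $q=\dim\ker J^\star$, let $V\in\mathbb R^{n\times q}$ and $\bar V,W\in\mathbb R^{n\times(n-q)}$ have orthonormal columns spanning $\ker J^\star$, $(\ker J^\star)^\perp$ and $\operatorname{range}J^\star$, and write $\Gamma(\alpha,\beta)=V\alpha+\bar V\beta$, $\alpha_0=V^\top x^\star$, $\beta_0=\bar V^\top x^\star$. With spectral norms and Euclidean open balls put $$M_\parallel=\big\|[\,0\;\;W^\top D_u\Phi(x^\star,u^\star)]\big\|,\qquad M_\perp=\big\|(W^\top J^\star\bar V)^{-1}\big\|,$$ $$L_\parallel=\sup\big\|W^\top\big[D_x\Phi(\Gamma(\alpha,\beta_0),u)V\;\;\; D_u\Phi(\Gamma(\alpha,\beta_0),u)-D_u\Phi(x^\star,u^\star)\big]\big\|,$$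 $$L_\perp=\sup\big\|W^\top\big(D_x\Phi(\Gamma(\alpha,\beta),u)-J^\star\big)\bar V\big\|,$$ the suprema being over $(\alpha,u)\in B((\alpha_0,u^\star),R_\parallel)$ and, for $L_\perp$, also $\beta\in B(\beta_0,R_\perp)$. Radii $R_\parallel,R_\perp>0$ are *within the bounds of validity* of the reduction at $(x^\star,u^\star)$ if $L_\parallel,L_\perp<\infty$ and $$L_\parallel R_\parallel+L_\perp R_\perp<\frac{R_\perp}{M_\perp}-M_\parallel R_\parallel,\qquad M_\perp L_\perp<1 .$$ Claim. The complete graph is $(n-1)$-regular, and its adjacency eigenvalues are $\lambda_1(A)=n-1$ and $\lambda_j(A)=-1$ for $2\le j\le n$. Hence the bound $\frac{d(k-\lambda_2(A))}{k\max\{|\lambda_2(A)|,|\lambda_n(A)|\}}$ for $k$-regular graphs (here $k=n-1$) equals $n\,u^\star=\frac{dn}{n-1}$. The point $(0,u^\star)$ is a singular equilibrium, with $\Phi(0,u^\star)=0$ and $\ker J^\star=\operatorname{span}\{\mathbf 1_n\}$, so $q=1$. For every choice of $V,\bar V,W$, the radii $R_\parallel,R_\perp$ are within the bounds of validity if and only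 if $$0<R_\parallel<n\,u^\star=\frac{dn}{n-1}\qquad\text{and}\qquad R_\perp>0$$ (that is, $0<R_\parallel<n$ and $R_\perp>0$ when $d=n-1$, i.e. $u^\star=1$). For all such radii there is a smooth map $\varphi:B((\alpha_0,u^\star),R_\parallel)\to B(\beta_0,R_\perp)$ with $\varphi(\alpha_0,u^\star)=\beta_0$ such that, for $(\alpha,u)$ and $\beta$ in these balls, $W^\top\Phi(\Gamma(\alpha,\beta),u)=0$ if and only if $\beta=\varphi(\alpha,u)$. -/

import Mathlib

open scoped ContDiff

noncomputable section

namespace LyapunovSchmidt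

/-- `ℝⁿ` with the Euclidean norm. -/
abbrev E (n : ℕ) := EuclideanSpace ℝ (Fin n)

/-- The partial derivative `D_x Φ(x, p)`. -/
def Dx {n : ℕ} (Φ : E n → ℝ → E n) (x : E n) (p : ℝ) : E n →L[ℝ] E n :=
  fderiv ℝ (fun y => Φ y p) x

/-- The partial derivative `D_p Φ(x, p)`. -/
def Dp {n : ℕ} (Φ : E n → ℝ → E n) (x : E n) (p : ℝ) : ℝ →L[ℝ] E n :=
  fderiv ℝ (fun v => Φ x v) p

/-- Matrices `V`, `V̄`, `W` with orthonormal columns whose images are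
`ker J`, `(ker J)ᗮ` and `range J`, viewed as linear isometric embeddings. -/
structure Frame {n : ℕ} (J : E n →L[ℝ] E n) (q r : ℕ) where
  V : E q →ₗᵢ[ℝ] E n
  Vbar : E r →ₗᵢ[ℝ] E n
  W : E r →ₗᵢ[ℝ] E n
  range_V : LinearMap.range V.toLinearMap = LinearMap.ker J.toLinearMap
  range_Vbar : LinearMap.range Vbar.toLinearMap = (LinearMap.ker J.toLinearMap)ᗮ
  range_W : LinearMap.range W.toLinearMap = LinearMap.range J.toLinearMap

namespace Frame

variable {n q r : ℕ} {J : E n →L[ℝ] E n} (F : Frame J q r)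

/-- `Vᵀ`. -/
def Vt : E n →L[ℝ] E q := ContinuousLinearMap.adjoint F.V.toContinuousLinearMap

/-- `V̄ᵀ`. -/
def VbarT : E n →L[ℝ] E r := ContinuousLinearMap.adjoint F.Vbar.toContinuousLinearMap

/-- `Wᵀ`. -/
def Wt : E n →L[ℝ] E r := ContinuousLinearMap.adjoint F.W.toContinuousLinearMap

/-- `Γ(α, β) = V α + V̄ β`. -/
def Γ (a : E q) (b : E r) : E n := F.V a + F.Vbar b

/-- The open ball around `(α₀, p⋆)`, `α₀ = Vᵀ x⋆`, in the Euclidean norm of `ℝ^q × ℝ`. -/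
def ballPar (xs : E n) (ps R : ℝ) : Set (WithLp 2 (E q × ℝ)) :=
  Metric.ball (WithLp.toLp 2 (F.Vt xs, ps)) R

/-- The open ball around `β₀ = V̄ᵀ x⋆`. -/
def ballPerp (xs : E n) (R : ℝ) : Set (E r) := Metric.ball (F.VbarT xs) R

variable (Φ : E n → ℝ → E n) (xs : E n) (ps : ℝ)

/-- `M_∥ = ‖[0, Wᵀ D_p Φ(x⋆, p⋆)]‖`. -/
def Mpar : ℝ :=
  ‖(F.Wt ∘L Dp Φ xs ps ∘L WithLp.sndL 2 ℝ (E q) ℝ : WithLp 2 (E q × ℝ) →L[ℝ] E r)‖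

/-- `M_⊥ = ‖(Wᵀ D_x Φ(x⋆, p⋆) V̄)⁻¹‖`. -/
def Mperp : ℝ :=
  ‖ContinuousLinearMap.inverse (F.Wt ∘L Dx Φ xs ps ∘L F.Vbar.toContinuousLinearMap)‖

/-- `ξ_∥(α, p) = Wᵀ [D_x Φ(Γ(α, β₀), p) V, D_p Φ(Γ(α, β₀), p) - D_p Φ(x⋆, p⋆)]`. -/
def xiPar (a : E q) (p : ℝ) : WithLp 2 (E q × ℝ) →L[ℝ] E r :=
  F.Wt ∘L
    (Dx Φ (F.Γ a (F.VbarT xs)) p ∘L F.V.toContinuousLinearMap ∘L WithLp.fstL 2 ℝ (E q) ℝ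
      + (Dp Φ (F.Γ a (F.VbarT xs)) p - Dp Φ xs ps) ∘L WithLp.sndL 2 ℝ (E q) ℝ)

/-- `ξ_⊥(α, β, p) = Wᵀ (D_x Φ(Γ(α, β), p) - D_x Φ(x⋆, p⋆)) V̄`. -/
def xiPerp (a : E q) (b : E r) (p : ℝ) : E r →L[ℝ] E r :=
  F.Wt ∘L (Dx Φ (F.Γ a b) p - Dx Φ xs ps) ∘L F.Vbar.toContinuousLinearMap

/-- The set of norms whose supremum is `L_∥`. -/
def normsPar (Rpar : ℝ) : Set ℝ :=
  {t | ∃ z ∈ F.ballPar xs ps Rpar, t = ‖F.xiPar Φ xs ps z.fst z.snd‖}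

/-- The set of norms whose supremum is `L_⊥`. -/
def normsPerp (Rpar Rperp : ℝ) : Set ℝ :=
  {t | ∃ z ∈ F.ballPar xs ps Rpar, ∃ b ∈ F.ballPerp xs Rperp,
    t = ‖F.xiPerp Φ xs ps z.fst b z.snd‖}

/-- `L_∥`. -/
def Lpar (Rpar : ℝ) : ℝ := sSup (F.normsPar Φ xs ps Rpar)

/-- `L_⊥`. -/
def Lperp (Rpar Rperp : ℝ) : ℝ := sSup (F.normsPerp Φ xs ps Rpar Rperp)

/-- The bounds of validity of the Lyapunov–Schmidt reduction at `(x⋆, p⋆)`: both radii are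
positive, the suprema `L_∥`, `L_⊥` are finite, and
`L_∥ R_∥ + L_⊥ R_⊥ < R_⊥ / M_⊥ - M_∥ R_∥`, `M_⊥ L_⊥ < 1`. -/
structure WithinBounds (Rpar Rperp : ℝ) : Prop where
  par_pos : 0 < Rpar
  perp_pos : 0 < Rperp
  bdd_par : BddAbove (F.normsPar Φ xs ps Rpar)
  bdd_perp : BddAbove (F.normsPerp Φ xs ps Rpar Rperp)
  main : F.Lpar Φ xs ps Rpar * Rpar + F.Lperp Φ xs ps Rpar Rperp * Rperp
    < Rperp / F.Mperp Φ xs ps - F.Mpar Φ xs ps * Rpar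
  contraction : F.Mperp Φ xs ps * F.Lperp Φ xs ps Rpar Rperp < 1

/-- `φ` is the smooth implicit map `B((α₀, p⋆), R_∥) → B(β₀, R_⊥)` of the reduction:
`φ(α₀, p⋆) = β₀`, and within the two balls `Wᵀ Φ(Γ(α, β), p) = 0` holds exactly for
`β = φ(α, p)`. -/
structure IsImplicitMap (Rpar Rperp : ℝ) (φ : WithLp 2 (E q × ℝ) → E r) : Prop where
  mapsTo : Set.MapsTo φ (F.ballPar xs ps Rpar) (F.ballPerp xs Rperp)
  smooth : ContDiffOn ℝ ∞ φ (F.ballPar xs ps Rpar)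
  base : φ (WithLp.toLp 2 (F.Vt xs, ps)) = F.VbarT xs
  solves : ∀ z ∈ F.ballPar xs ps Rpar, ∀ b ∈ F.ballPerp xs Rperp,
    F.Wt (Φ (F.Γ z.fst b) z.snd) = 0 ↔ b = φ z

end Frame

section Graph

variable {n : ℕ} (G : SimpleGraph (Fin n)) [DecidableRel G.Adj]

/-- The opinion dynamics `Φ(x, u) = -d x + u A tanh(x)` over a graph with adjacency matrix `A`. -/
def opinionField (d : ℝ) (x : E n) (u : ℝ) : E n :=
  -(d • x) + u • WithLp.toLp 2 ((G.adjMatrix ℝ).mulVec fun i => Real.tanh (x i))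

/-- The adjacency eigenvalues `λ_1 ≥ ⋯ ≥ λ_n`, with multiplicity; `adjEig G j` is `λ_{j+1}`. -/
def adjEig (j : Fin n) : ℝ :=
  (G.isHermitian_adjMatrix ℝ).eigenvalues₀ (Fin.cast (Fintype.card_fin n).symm j)

/-- The bound `d (k - λ_2) / (k |λ'|)`, `|λ'| = max (|λ_2|, |λ_n|)`, for a `k`-regular graph
on `n ≥ 2` nodes. -/
def regularBound (hn : 2 ≤ n) (d : ℝ) (k : ℕ) : ℝ :=
  d * (k - adjEig G ⟨1, by omega⟩) /
    (k * max |adjEig G ⟨1, by omega⟩| |adjEig G ⟨n - 1, by omega⟩|)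

end Graph

end LyapunovSchmidt

end

/-!
The Jacobian `J⋆` at `(0, u⋆)` is self-adjoint with kernel the consensus line `span {𝟏}`, so `Wᵀ`
annihilates exactly that line and is isometric on its orthogonal complement. Since
`A v + v ∈ span {𝟏}` for every `v`, modulo consensus the coupling is diagonal:
`Wᵀ Φ(x, u) = -Wᵀ (d x + u tanh x)`. Hence `M_∥ = L_∥ = 0` and `M_⊥ = 1 / (d + u⋆) = 1 / (n u⋆)`,
while `‖ξ_⊥‖` is governed by the diagonal entries `u sech² - u⋆` with `0 < sech² ≤ 1`. This gives
`R_∥ ≤ L_⊥ ≤ max u⋆ R_∥`, and both validity inequalities reduce to `L_⊥ < n u⋆`, that is, to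
`R_∥ < n u⋆`. The implicit map is `φ = 0`, because `t ↦ d t + u tanh t` is injective when `u > -d`.
-/

namespace LyapunovSchmidt

section Spectrum

open Polynomial

theorem charpoly_adjMatrix_top (V : Type*) [Fintype V] [DecidableEq V] [Nonempty V]
    (R : Type*) [CommRing R] :
    ((⊤ : SimpleGraph V).adjMatrix R).charpoly
      = (X - C ((Fintype.card V : R) - 1)) * (X + 1) ^ (Fintype.card V - 1) := by
  have hA : (⊤ : SimpleGraph V).adjMatrix R
      = Matrix.vecMulVec 1 1 - Matrix.scalar V (1 : R) := by
    ext i j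
    simp [Matrix.one_apply, sub_ite]
  obtain ⟨m, hm⟩ := Nat.exists_eq_succ_of_ne_zero (Fintype.card_ne_zero (α := V))
  rw [hA, Matrix.charpoly_sub_scalar, Matrix.charpoly_vecMulVec]
  simp only [hm, Nat.succ_eq_add_one, one_dotProduct_one, Nat.cast_add, Nat.cast_one,
    add_tsub_cancel_right, smul_eq_C_mul, map_add, map_natCast, map_one, sub_comp, pow_comp, X_comp,
    mul_comp, add_comp, natCast_comp, one_comp, add_sub_cancel_right]
  ring

theorem roots_charpoly_adjMatrix_top (V : Type*) [Fintype V] [DecidableEq V] [Nonempty V]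
    (R : Type*) [CommRing R] [IsDomain R] :
    ((⊤ : SimpleGraph V).adjMatrix R).charpoly.roots
      = ((Fintype.card V : R) - 1) ::ₘ Multiset.replicate (Fintype.card V - 1) (-1) := by
  have hX : (X + 1 : R[X]) = X - C (-1) := by simp
  have hne : (X - C ((Fintype.card V : R) - 1)) * (X - C (-1)) ^ (Fintype.card V - 1) ≠ 0 :=
    mul_ne_zero (X_sub_C_ne_zero _) (pow_ne_zero _ (X_sub_C_ne_zero _))
  rw [charpoly_adjMatrix_top, hX, roots_mul hne, roots_pow, roots_X_sub_C, roots_X_sub_C,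
    Multiset.nsmul_singleton, Multiset.singleton_add]

theorem adjEig_top {n : ℕ} (j : Fin n) :
    adjEig (⊤ : SimpleGraph (Fin n)) j = if j.val = 0 then (n : ℝ) - 1 else -1 := by
  have : Nonempty (Fin n) := ⟨j⟩
  have hsort : List.ofFn ((⊤ : SimpleGraph (Fin n)).isHermitian_adjMatrix ℝ).eigenvalues₀
      = ((n : ℝ) - 1) :: List.replicate (n - 1) (-1) := by
    have hle : ∀ b ∈ Multiset.replicate (n - 1) (-1 : ℝ), (n : ℝ) - 1 ≥ b := fun b hb => by
      rw [Multiset.eq_of_mem_replicate hb]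
      linarith [n.cast_nonneg (α := ℝ)]
    rw [← Matrix.IsHermitian.sort_roots_charpoly_eq_eigenvalues₀, roots_charpoly_adjMatrix_top]
    simp only [Multiset.map_cons, Multiset.map_replicate, RCLike.re_to_real, Fintype.card_fin]
    rw [Multiset.sort_cons _ _ _ hle, List.cons_inj_right, List.eq_replicate_iff]
    exact ⟨by simp, fun b hb => Multiset.eq_of_mem_replicate ((Multiset.mem_sort _).mp hb)⟩
  have hj : (List.ofFn ((⊤ : SimpleGraph (Fin n)).isHermitian_adjMatrix ℝ).eigenvalues₀)[j.val]?
      = some (adjEig (⊤ : SimpleGraph (Fin n)) j) := by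
    simp [adjEig]
  rw [hsort, List.getElem?_cons, List.getElem?_replicate] at hj
  split_ifs at hj ⊢
  · simpa using hj.symm
  · simpa using hj.symm

theorem regularBound_top {n : ℕ} (hn : 2 ≤ n) (d : ℝ) :
    regularBound (⊤ : SimpleGraph (Fin n)) hn d (n - 1) = n * (d / ((n : ℝ) - 1)) := by
  have hpred : n - 1 ≠ 0 := by omega
  simp only [regularBound, adjEig_top, hpred, one_ne_zero, if_false]
  rw [Nat.cast_pred (by omega), sub_neg_eq_add, sub_add_cancel, abs_neg, abs_one, max_self, mul_one,
    mul_comm d, mul_div_assoc]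

end Spectrum

section Operators

theorem norm_inverse_of_norm_apply_eq {𝕜 V : Type*} [NontriviallyNormedField 𝕜]
    [CompleteSpace 𝕜] [NormedAddCommGroup V] [NormedSpace 𝕜 V] [FiniteDimensional 𝕜 V]
    [Nontrivial V] {T : V →L[𝕜] V} {c : ℝ} (hc : 0 < c) (hT : ∀ v, ‖T v‖ = c * ‖v‖) :
    ‖T.inverse‖ = c⁻¹ := by
  have hinj : Function.Injective T.toLinearMap :=
    (injective_iff_map_eq_zero T.toLinearMap).mpr fun v hv => by
      have hcv : c * ‖v‖ = 0 := (hT v).symm.trans (norm_eq_zero.mpr hv)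
      exact norm_eq_zero.mp ((mul_eq_zero.mp hcv).resolve_left hc.ne')
  let e : V ≃L[𝕜] V :=
    (LinearEquiv.ofInjectiveEndo T.toLinearMap hinj).toContinuousLinearEquiv
  have he : (e : V →L[𝕜] V) = T := rfl
  rw [← he, ContinuousLinearMap.inverse_equiv]
  refine ContinuousLinearMap.homothety_norm _ fun v => ?_
  have hv : ‖v‖ = c * ‖e.symm v‖ := by rw [← hT, ← he]; simp
  rw [hv, inv_mul_cancel_left₀ hc.ne']
  rfl

variable {n : ℕ}

/-- The adjacency matrix of a graph as an operator on Euclidean space. -/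
noncomputable def adjCLM (G : SimpleGraph (Fin n)) [DecidableRel G.Adj] : E n →L[ℝ] E n :=
  Matrix.toEuclideanCLM (𝕜 := ℝ) (G.adjMatrix ℝ)

/-- The diagonal matrix with entries `m` as an operator on Euclidean space. -/
noncomputable def diagCLM (m : Fin n → ℝ) : E n →L[ℝ] E n :=
  Matrix.toEuclideanCLM (𝕜 := ℝ) (Matrix.diagonal m)

/-- The componentwise hyperbolic tangent. -/
noncomputable def tanhVec (x : E n) : E n := WithLp.toLp 2 fun i => Real.tanh (x i)

/-- The consensus line `span {𝟏}` of states in which all opinions agree. -/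
noncomputable def consensus (n : ℕ) : Submodule ℝ (E n) :=
  Submodule.span ℝ {WithLp.toLp 2 fun _ => 1}

theorem diagCLM_apply (m : Fin n → ℝ) (v : E n) (i : Fin n) : diagCLM m v i = m i * v i :=
  Matrix.mulVec_diagonal m v i

theorem diagCLM_const (c : ℝ) :
    diagCLM (fun _ : Fin n => c) = c • ContinuousLinearMap.id ℝ (E n) := by
  ext v i
  simp [diagCLM_apply]

open scoped Matrix.Norms.L2Operator in
theorem norm_diagCLM (m : Fin n → ℝ) : ‖diagCLM m‖ = ‖m‖ :=
  Matrix.l2_opNorm_diagonal m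

theorem isSelfAdjoint_adjCLM (G : SimpleGraph (Fin n)) [DecidableRel G.Adj] :
    IsSelfAdjoint (adjCLM G) :=
  (G.isHermitian_adjMatrix ℝ).isSelfAdjoint.map _

theorem mem_consensus_iff {v : E n} : v ∈ consensus n ↔ ∀ i j, v i = v j := by
  rw [consensus, Submodule.mem_span_singleton]
  constructor
  · rintro ⟨c, rfl⟩ i j
    simp
  · intro h
    refine ⟨(∑ j, v j) / n, ?_⟩
    ext i
    have hn : (n : ℝ) ≠ 0 := Nat.cast_ne_zero.mpr i.pos.ne'
    simp [fun j => h j i, hn]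

theorem adjCLM_top_apply (v : E n) (i : Fin n) :
    adjCLM (⊤ : SimpleGraph (Fin n)) v i = ∑ j, v j - v i := by
  calc adjCLM (⊤ : SimpleGraph (Fin n)) v i
      = ∑ j ∈ (⊤ : SimpleGraph (Fin n)).neighborFinset i, v j :=
        SimpleGraph.adjMatrix_mulVec_apply _ i v.ofLp
    _ = ∑ j, v j - v i := by
      rw [SimpleGraph.neighborFinset_eq_filter]
      simp [Finset.filter_ne, Finset.sum_erase_eq_sub]

theorem adjCLM_top_add_self_mem_consensus (v : E n) :
    adjCLM (⊤ : SimpleGraph (Fin n)) v + v ∈ consensus n :=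
  mem_consensus_iff.mpr fun i j => by simp [adjCLM_top_apply]

end Operators

section Field

theorem hasDerivAt_tanh (t : ℝ) : HasDerivAt Real.tanh (1 - Real.tanh t ^ 2) t := by
  have hcosh := (Real.cosh_pos t).ne'
  rw [show Real.tanh = Real.sinh / Real.cosh from funext Real.tanh_eq_sinh_div_cosh]
  refine ((Real.hasDerivAt_sinh t).div (Real.hasDerivAt_cosh t) hcosh).congr_deriv ?_
  rw [Pi.div_apply]
  field_simp

theorem abs_mul_sub_le_max {s u u₀ : ℝ} (hs₀ : 0 ≤ s) (hs₁ : s ≤ 1) :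
    |u * s - u₀| ≤ max |u₀| |u - u₀| := by
  have hs : 0 ≤ 1 - s := sub_nonneg.mpr hs₁
  calc |u * s - u₀| = |(1 - s) * -u₀ + s * (u - u₀)| := by ring_nf
    _ ≤ |(1 - s) * -u₀| + |s * (u - u₀)| := abs_add_le _ _
    _ = (1 - s) * |u₀| + s * |u - u₀| := by
      rw [abs_mul, abs_mul, abs_neg, abs_of_nonneg hs, abs_of_nonneg hs₀]
    _ ≤ max |u₀| |u - u₀| := Convex.combo_le_max _ _ hs hs₀ (sub_add_cancel 1 s)

theorem strictMono_mul_add_mul_tanh {d u : ℝ} (hd : 0 ≤ d) (hu : -d < u) :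
    StrictMono fun t => d * t + u * Real.tanh t := by
  refine strictMono_of_deriv_pos fun t => ?_
  have hderiv : HasDerivAt (fun t => d * t + u * Real.tanh t)
      (d * 1 + u * (1 - Real.tanh t ^ 2)) t :=
    ((hasDerivAt_id t).const_mul d).add ((hasDerivAt_tanh t).const_mul u)
  have hsech : 0 < 1 - Real.tanh t ^ 2 := sub_pos.mpr (Real.tanh_sq_lt_one t)
  calc 0 < d * Real.tanh t ^ 2 + (d + u) * (1 - Real.tanh t ^ 2) := by
        have := mul_pos (neg_lt_iff_pos_add'.mp hu) hsech
        positivity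
    _ = _ := by rw [hderiv.deriv]; ring

variable {n : ℕ}

theorem tanhVec_zero : tanhVec (0 : E n) = 0 := by
  ext i
  simp [tanhVec]

theorem tanhVec_mem_consensus {x : E n} (hx : x ∈ consensus n) : tanhVec x ∈ consensus n :=
  mem_consensus_iff.mpr fun i j => congrArg Real.tanh (mem_consensus_iff.mp hx i j)

theorem hasFDerivAt_tanhVec (x : E n) :
    HasFDerivAt tanhVec (diagCLM fun i => 1 - Real.tanh (x i) ^ 2) x := by
  simp only [← hasFDerivWithinAt_univ, hasFDerivWithinAt_euclidean]
  intro i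
  have hproj : HasFDerivAt (fun y : E n => y i) (EuclideanSpace.proj i : E n →L[ℝ] ℝ) x :=
    (EuclideanSpace.proj i : E n →L[ℝ] ℝ).hasFDerivAt
  refine ((hasDerivAt_tanh (x i)).comp_hasFDerivWithinAt (f := fun y : E n => y i) x
    hproj.hasFDerivWithinAt).congr_fderiv ?_
  ext v
  simp [diagCLM_apply]

variable (G : SimpleGraph (Fin n)) [DecidableRel G.Adj]

theorem opinionField_eq (d : ℝ) (x : E n) (u : ℝ) :
    opinionField G d x u = -(d • x) + u • adjCLM G (tanhVec x) :=
  rfl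

theorem opinionField_zero (d u : ℝ) : opinionField G d 0 u = 0 := by
  simp [opinionField_eq, tanhVec_zero]

theorem Dx_opinionField (d : ℝ) (x : E n) (u : ℝ) :
    Dx (opinionField G d) x u = -(d • ContinuousLinearMap.id ℝ (E n))
      + u • adjCLM G ∘L diagCLM fun i => 1 - Real.tanh (x i) ^ 2 := by
  refine HasFDerivAt.fderiv (f := fun y => -(d • y) + u • adjCLM G (tanhVec y)) ?_
  exact ((hasFDerivAt_id x).const_smul d).neg.add
    (((adjCLM G).hasFDerivAt.comp x (hasFDerivAt_tanhVec x)).const_smul u)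

theorem Dx_opinionField_zero (d u : ℝ) :
    Dx (opinionField G d) 0 u = -(d • ContinuousLinearMap.id ℝ (E n)) + u • adjCLM G := by
  ext1 v
  simp [Dx_opinionField, diagCLM_const]

theorem Dp_opinionField (d : ℝ) (x : E n) (u : ℝ) :
    Dp (opinionField G d) x u = ContinuousLinearMap.toSpanSingleton ℝ (adjCLM G (tanhVec x)) := by
  have h := ((hasDerivAt_id u).smul_const (adjCLM G (tanhVec x))).const_add (-(d • x))
  rw [one_smul] at h
  exact h.hasFDerivAt.fderiv

theorem isSelfAdjoint_Dx_opinionField_zero (d u : ℝ) :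
    IsSelfAdjoint (Dx (opinionField G d) 0 u) := by
  rw [Dx_opinionField_zero]
  simp [ContinuousLinearMap.isSelfAdjoint_iff', (isSelfAdjoint_adjCLM G).adjoint_eq,
    ContinuousLinearMap.adjoint_id]

theorem ker_Dx_opinionField_top_zero {d u : ℝ} (hu : u ≠ 0) (hd : d = (n - 1) * u) :
    LinearMap.ker (Dx (opinionField (⊤ : SimpleGraph (Fin n)) d) 0 u).toLinearMap
      = consensus n := by
  have hJ (v : E n) (i : Fin n) :
      Dx (opinionField (⊤ : SimpleGraph (Fin n)) d) 0 u v i = u * (∑ j, v j - n * v i) := by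
    simp only [hd, Dx_opinionField_zero, add_apply, neg_apply, smul_apply,
      ContinuousLinearMap.id_apply, PiLp.add_apply, PiLp.neg_apply, PiLp.smul_apply, smul_eq_mul,
      adjCLM_top_apply]
    ring
  ext v
  rw [LinearMap.mem_ker, mem_consensus_iff]
  constructor
  · intro hv
    have hmul (i : Fin n) : (n : ℝ) * v i = ∑ j, v j := by
      have hi : u * (∑ j, v j - n * v i) = 0 := by rw [← hJ]; exact congr($hv i)
      linarith [(mul_eq_zero.mp hi).resolve_left hu]
    exact fun i j => mul_left_cancel₀ (Nat.cast_ne_zero.mpr i.pos.ne')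
      ((hmul i).trans (hmul j).symm)
  · intro hv
    ext i
    exact (hJ v i).trans (by simp [fun j => hv j i])

end Field

namespace Frame

variable {n q r : ℕ} {J : E n →L[ℝ] E n} (F : Frame J q r)

section General

theorem abs_snd_sub_lt_of_mem_ballPar {xs : E n} {ps R : ℝ} {z : WithLp 2 (E q × ℝ)}
    (hz : z ∈ F.ballPar xs ps R) : |z.snd - ps| < R := by
  rw [ballPar, mem_ball_iff_norm] at hz
  exact (WithLp.norm_snd_le _ (z - WithLp.toLp 2 (F.Vt xs, ps))).trans_lt hz

theorem toLp_Vt_mem_ballPar_iff {xs : E n} {ps R u : ℝ} :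
    WithLp.toLp 2 (F.Vt xs, u) ∈ F.ballPar xs ps R ↔ |u - ps| < R := by
  rw [ballPar, mem_ball_iff_norm, WithLp.prod_norm_eq_of_L2]
  simp [Real.sqrt_sq_eq_abs]

theorem norm_Wt_le_one : ‖F.Wt‖ ≤ 1 := by
  rw [Wt, ContinuousLinearMap.adjoint.norm_map]
  exact F.W.norm_toContinuousLinearMap_le

theorem Wt_W (w : E r) : F.Wt (F.W w) = w :=
  ext_inner_right ℝ fun z =>
    (ContinuousLinearMap.adjoint_inner_left _ _ _).trans (F.W.inner_map_map w z)

theorem Wt_eq_zero_iff_mem_ker (hJ : IsSelfAdjoint J) {v : E n} :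
    F.Wt v = 0 ↔ v ∈ LinearMap.ker J.toLinearMap := by
  have hker : LinearMap.ker F.Wt.toLinearMap = LinearMap.ker J.toLinearMap := by
    rw [Wt, ← ContinuousLinearMap.orthogonal_range]
    exact (congrArg _ F.range_W).trans (J.orthogonal_range.trans (by rw [hJ.adjoint_eq]))
  rw [← hker, LinearMap.mem_ker, ContinuousLinearMap.coe_coe]

theorem norm_Wt_Vbar (hJ : IsSelfAdjoint J) (b : E r) : ‖F.Wt (F.Vbar b)‖ = ‖b‖ := by
  have hrange : (LinearMap.ker J.toLinearMap)ᗮ = LinearMap.range J.toLinearMap := by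
    rw [← J.toLinearMap.range.orthogonal_orthogonal, J.orthogonal_range, hJ.adjoint_eq]
  have hmem : F.Vbar b ∈ LinearMap.range F.W.toLinearMap := by
    rw [F.range_W, ← hrange, ← F.range_Vbar]
    exact ⟨b, rfl⟩
  obtain ⟨w, hw⟩ := hmem
  change F.W w = F.Vbar b at hw
  rw [← hw, F.Wt_W, ← F.W.norm_map, hw, F.Vbar.norm_map]

theorem Γ_mem_ker_iff {a : E q} {b : E r} :
    F.Γ a b ∈ LinearMap.ker J.toLinearMap ↔ b = 0 := by
  have ha : F.V a ∈ LinearMap.ker J.toLinearMap := F.range_V ▸ ⟨a, rfl⟩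
  have hb : F.Vbar b ∈ (LinearMap.ker J.toLinearMap)ᗮ := F.range_Vbar ▸ ⟨b, rfl⟩
  rw [Γ, Submodule.add_mem_iff_right _ ha, ← map_eq_zero_iff F.Vbar F.Vbar.injective]
  refine ⟨fun h => ?_, fun h => h ▸ Submodule.zero_mem _⟩
  exact Submodule.disjoint_def.mp (Submodule.orthogonal_disjoint _) _ h hb

theorem Mpar_opinionField_zero (G : SimpleGraph (Fin n)) [DecidableRel G.Adj] (d us : ℝ) :
    F.Mpar (opinionField G d) 0 us = 0 := by
  simp [Mpar, Dp_opinionField, tanhVec_zero]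

end General

section Consensus

variable (hJ : IsSelfAdjoint J) (hker : LinearMap.ker J.toLinearMap = consensus n)

include hJ hker

theorem Wt_eq_zero_iff_mem_consensus {v : E n} : F.Wt v = 0 ↔ v ∈ consensus n := by
  rw [F.Wt_eq_zero_iff_mem_ker hJ, hker]

theorem Wt_adjCLM_top (v : E n) :
    F.Wt (adjCLM (⊤ : SimpleGraph (Fin n)) v) = -F.Wt v := by
  rw [← add_eq_zero_iff_eq_neg, ← map_add, F.Wt_eq_zero_iff_mem_consensus hJ hker]
  exact adjCLM_top_add_self_mem_consensus v

theorem Wt_opinionField_top (d : ℝ) (x : E n) (u : ℝ) :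
    F.Wt (opinionField (⊤ : SimpleGraph (Fin n)) d x u) = -F.Wt (d • x + u • tanhVec x) := by
  simp only [opinionField_eq, map_add, map_neg, map_smul, F.Wt_adjCLM_top hJ hker]
  module

theorem Wt_comp_Dx_opinionField_top (d : ℝ) (x : E n) (u : ℝ) :
    F.Wt ∘L Dx (opinionField (⊤ : SimpleGraph (Fin n)) d) x u
      = -(F.Wt ∘L diagCLM fun i => d + u * (1 - Real.tanh (x i) ^ 2)) := by
  ext1 v
  have hdiag : (diagCLM fun i => d + u * (1 - Real.tanh (x i) ^ 2)) v
      = d • v + u • (diagCLM fun i => 1 - Real.tanh (x i) ^ 2) v := by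
    ext i
    simp only [diagCLM_apply, PiLp.add_apply, PiLp.smul_apply, smul_eq_mul]
    ring
  simp only [Dx_opinionField, ContinuousLinearMap.comp_apply, add_apply, neg_apply, smul_apply,
    ContinuousLinearMap.id_apply, map_add, map_neg, map_smul, F.Wt_adjCLM_top hJ hker, hdiag]
  module

theorem xiPerp_opinionField_top (d us : ℝ) (a : E q) (b : E r) (u : ℝ) :
    F.xiPerp (opinionField (⊤ : SimpleGraph (Fin n)) d) 0 us a b u
      = -(F.Wt ∘L diagCLM (fun i => u * (1 - Real.tanh (F.Γ a b i) ^ 2) - us) ∘L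
          F.Vbar.toContinuousLinearMap) := by
  have hdiff : (diagCLM fun i => u * (1 - Real.tanh (F.Γ a b i) ^ 2) - us)
      = (diagCLM fun i => d + u * (1 - Real.tanh (F.Γ a b i) ^ 2))
        - diagCLM fun i => d + us * (1 - Real.tanh ((0 : E n) i) ^ 2) := by
    ext v i
    simp only [diagCLM_apply, sub_apply, PiLp.sub_apply, PiLp.zero_apply, Real.tanh_zero]
    ring
  rw [xiPerp, ← ContinuousLinearMap.comp_assoc, ContinuousLinearMap.comp_sub,
    F.Wt_comp_Dx_opinionField_top hJ hker, F.Wt_comp_Dx_opinionField_top hJ hker,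
    ← ContinuousLinearMap.comp_assoc, hdiff, ContinuousLinearMap.comp_sub]
  ext1 v
  simp only [ContinuousLinearMap.comp_apply, sub_apply, neg_apply]
  abel

theorem norm_xiPerp_opinionField_top_le (d us : ℝ) (a : E q) (b : E r) (u : ℝ) :
    ‖F.xiPerp (opinionField (⊤ : SimpleGraph (Fin n)) d) 0 us a b u‖ ≤ max |us| |u - us| := by
  have hdiag : ‖diagCLM fun i => u * (1 - Real.tanh (F.Γ a b i) ^ 2) - us‖
      ≤ max |us| |u - us| := by
    rw [norm_diagCLM, pi_norm_le_iff_of_nonneg (le_max_of_le_left (abs_nonneg us))]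
    exact fun i => abs_mul_sub_le_max
      (sub_nonneg.mpr (Real.tanh_sq_lt_one _).le) (sub_le_self _ (sq_nonneg _))
  rw [F.xiPerp_opinionField_top hJ hker, norm_neg]
  refine (ContinuousLinearMap.opNorm_comp_le _ _).trans ?_
  refine (mul_le_of_le_one_left (norm_nonneg _) F.norm_Wt_le_one).trans ?_
  refine (ContinuousLinearMap.opNorm_comp_le _ _).trans ?_
  exact (mul_le_of_le_one_right (norm_nonneg _) F.Vbar.norm_toContinuousLinearMap_le).trans hdiag

theorem norm_xiPerp_opinionField_top_zero [NeZero r] (d us u : ℝ) :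
    ‖F.xiPerp (opinionField (⊤ : SimpleGraph (Fin n)) d) 0 us 0 0 u‖ = |u - us| := by
  refine ContinuousLinearMap.homothety_norm _ fun b => ?_
  rw [F.xiPerp_opinionField_top hJ hker]
  simp [Γ, diagCLM_const, norm_smul, F.norm_Wt_Vbar hJ]

theorem Wt_Dx_opinionField_top_of_mem_consensus (d : ℝ) {x v : E n} (hx : x ∈ consensus n)
    (hv : v ∈ consensus n) (u : ℝ) :
    F.Wt (Dx (opinionField (⊤ : SimpleGraph (Fin n)) d) x u v) = 0 := by
  have hdiag : (diagCLM fun i => d + u * (1 - Real.tanh (x i) ^ 2)) v ∈ consensus n :=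
    mem_consensus_iff.mpr fun i j => by
      rw [diagCLM_apply, diagCLM_apply, mem_consensus_iff.mp hx i j, mem_consensus_iff.mp hv i j]
  calc F.Wt (Dx (opinionField (⊤ : SimpleGraph (Fin n)) d) x u v)
      = -F.Wt ((diagCLM fun i => d + u * (1 - Real.tanh (x i) ^ 2)) v) :=
        congr($(F.Wt_comp_Dx_opinionField_top hJ hker d x u) v)
    _ = 0 := neg_eq_zero.mpr ((F.Wt_eq_zero_iff_mem_consensus hJ hker).mpr hdiag)

theorem Wt_Dp_opinionField_top_of_mem_consensus (d : ℝ) {x : E n} (hx : x ∈ consensus n)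
    (u t : ℝ) : F.Wt (Dp (opinionField (⊤ : SimpleGraph (Fin n)) d) x u t) = 0 := by
  have htanh : F.Wt (tanhVec x) = 0 :=
    (F.Wt_eq_zero_iff_mem_consensus hJ hker).mpr (tanhVec_mem_consensus hx)
  simp [Dp_opinionField, F.Wt_adjCLM_top hJ hker, htanh]

theorem xiPar_opinionField_top (d us : ℝ) (a : E q) (u : ℝ) :
    F.xiPar (opinionField (⊤ : SimpleGraph (Fin n)) d) 0 us a u = 0 := by
  have hV (a : E q) : F.V a ∈ consensus n := hker ▸ F.range_V ▸ ⟨a, rfl⟩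
  have hΓ : F.Γ a 0 ∈ consensus n := by simpa [Γ] using hV a
  ext1 z
  simp [xiPar, F.Wt_Dx_opinionField_top_of_mem_consensus hJ hker d hΓ (hV _),
    F.Wt_Dp_opinionField_top_of_mem_consensus hJ hker d hΓ,
    F.Wt_Dp_opinionField_top_of_mem_consensus hJ hker d (zero_mem _)]

theorem normsPar_opinionField_top_subset (d us R : ℝ) :
    F.normsPar (opinionField (⊤ : SimpleGraph (Fin n)) d) 0 us R ⊆ {0} := by
  rintro t ⟨z, -, rfl⟩
  rw [F.xiPar_opinionField_top hJ hker, norm_zero, Set.mem_singleton_iff]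

theorem Lpar_opinionField_top (d us R : ℝ) :
    F.Lpar (opinionField (⊤ : SimpleGraph (Fin n)) d) 0 us R = 0 := by
  rcases Set.subset_singleton_iff_eq.mp
    (F.normsPar_opinionField_top_subset hJ hker d us R) with h | h
  · rw [Lpar, h, Real.sSup_empty]
  · rw [Lpar, h, csSup_singleton]

theorem max_mem_upperBounds_normsPerp_opinionField_top (d us Rpar Rperp : ℝ) :
    max |us| Rpar ∈ upperBounds
      (F.normsPerp (opinionField (⊤ : SimpleGraph (Fin n)) d) 0 us Rpar Rperp) := by
  rintro t ⟨z, hz, b, -, rfl⟩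
  exact (F.norm_xiPerp_opinionField_top_le hJ hker d us z.fst b z.snd).trans
    (max_le_max_left _ (F.abs_snd_sub_lt_of_mem_ballPar hz).le)

theorem Lperp_opinionField_top_le (d us Rpar Rperp : ℝ) :
    F.Lperp (opinionField (⊤ : SimpleGraph (Fin n)) d) 0 us Rpar Rperp ≤ max |us| Rpar :=
  Real.sSup_le (F.max_mem_upperBounds_normsPerp_opinionField_top hJ hker d us Rpar Rperp)
    (le_max_of_le_left (abs_nonneg us))

theorem le_Lperp_opinionField_top [NeZero r] (d us : ℝ) {Rpar Rperp : ℝ} (hpar : 0 < Rpar)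
    (hperp : 0 < Rperp) :
    Rpar ≤ F.Lperp (opinionField (⊤ : SimpleGraph (Fin n)) d) 0 us Rpar Rperp := by
  refine le_of_forall_lt_imp_le_of_dense fun t ht => ?_
  have hmax : |us + max t 0 - us| = max t 0 := by
    rw [add_sub_cancel_left, abs_of_nonneg (le_max_right t 0)]
  refine (le_max_left t 0).trans (le_csSup
    ⟨_, F.max_mem_upperBounds_normsPerp_opinionField_top hJ hker d us Rpar Rperp⟩
    ⟨WithLp.toLp 2 (F.Vt 0, us + max t 0), ?_, 0, ?_, ?_⟩)
  · rw [F.toLp_Vt_mem_ballPar_iff, hmax]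
    exact max_lt ht hpar
  · simpa [ballPerp] using hperp
  · rw [WithLp.toLp_fst, WithLp.toLp_snd, map_zero, F.norm_xiPerp_opinionField_top_zero hJ hker,
      hmax]

theorem Mperp_opinionField_top [NeZero r] {d us : ℝ} (h : 0 < d + us) :
    F.Mperp (opinionField (⊤ : SimpleGraph (Fin n)) d) 0 us = (d + us)⁻¹ := by
  refine norm_inverse_of_norm_apply_eq h fun b => ?_
  rw [← ContinuousLinearMap.comp_assoc, F.Wt_comp_Dx_opinionField_top hJ hker]
  simp [diagCLM_const, norm_smul, F.norm_Wt_Vbar hJ, abs_of_pos h]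

theorem withinBounds_opinionField_top_iff [NeZero r] {d us : ℝ} (hd : 0 < d) (hus : 0 ≤ us)
    (Rpar Rperp : ℝ) :
    F.WithinBounds (opinionField (⊤ : SimpleGraph (Fin n)) d) 0 us Rpar Rperp
      ↔ 0 < Rpar ∧ Rpar < d + us ∧ 0 < Rperp := by
  have hM := F.Mperp_opinionField_top hJ hker (add_pos_of_pos_of_nonneg hd hus)
  constructor
  · rintro ⟨hpar, hperp, -, -, -, hL⟩
    rw [hM, inv_mul_lt_one₀ (add_pos_of_pos_of_nonneg hd hus)] at hL
    exact ⟨hpar, (F.le_Lperp_opinionField_top hJ hker d us hpar hperp).trans_lt hL, hperp⟩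
  · rintro ⟨hpar, hlt, hperp⟩
    have hL : F.Lperp (opinionField (⊤ : SimpleGraph (Fin n)) d) 0 us Rpar Rperp < d + us :=
      (F.Lperp_opinionField_top_le hJ hker d us Rpar Rperp).trans_lt
        (max_lt (by rw [abs_of_nonneg hus]; exact lt_add_of_pos_left us hd) hlt)
    refine ⟨hpar, hperp,
      bddAbove_singleton.mono (F.normsPar_opinionField_top_subset hJ hker d us Rpar),
      ⟨_, F.max_mem_upperBounds_normsPerp_opinionField_top hJ hker d us Rpar Rperp⟩, ?_, ?_⟩
    · rw [F.Lpar_opinionField_top hJ hker, F.Mpar_opinionField_zero, hM, zero_mul,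
        zero_add, sub_zero, div_inv_eq_mul, mul_comm Rperp]
      exact mul_lt_mul_of_pos_right hL hperp
    · rwa [hM, inv_mul_lt_one₀ (add_pos_of_pos_of_nonneg hd hus)]

theorem Wt_opinionField_top_Γ_eq_zero_iff {d u : ℝ} (hd : 0 ≤ d) (hu : -d < u) (a : E q)
    (b : E r) : F.Wt (opinionField (⊤ : SimpleGraph (Fin n)) d (F.Γ a b) u) = 0 ↔ b = 0 := by
  rw [F.Wt_opinionField_top hJ hker, neg_eq_zero, F.Wt_eq_zero_iff_mem_consensus hJ hker,
    ← F.Γ_mem_ker_iff (a := a), hker]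
  refine ⟨fun h => ?_, fun h => ?_⟩
  · refine mem_consensus_iff.mpr fun i j => ?_
    exact (strictMono_mul_add_mul_tanh hd hu).injective (mem_consensus_iff.mp h i j)
  · exact add_mem (Submodule.smul_mem _ _ h) (Submodule.smul_mem _ _ (tanhVec_mem_consensus h))

theorem isImplicitMap_zero_opinionField_top {d us Rpar Rperp : ℝ} (hd : 0 ≤ d)
    (hpar : Rpar ≤ d + us) (hperp : 0 < Rperp) :
    F.IsImplicitMap (opinionField (⊤ : SimpleGraph (Fin n)) d) 0 us Rpar Rperp 0 where
  mapsTo _ _ := by simpa [ballPerp] using hperp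
  smooth := contDiffOn_const
  base := (map_zero F.VbarT).symm
  solves z hz b _ := by
    have hz := (abs_lt.mp (F.abs_snd_sub_lt_of_mem_ballPar hz)).1
    exact F.Wt_opinionField_top_Γ_eq_zero_iff hJ hker hd (by linarith) z.fst b

end Consensus

end Frame

end LyapunovSchmidt

open LyapunovSchmidt in
theorem mainTheorem5 (n : ℕ) (hn : 2 ≤ n) (d : ℝ) (hd : 0 < d)
    (us : ℝ) (hus : us = d / ((n : ℝ) - 1)) :
    (⊤ : SimpleGraph (Fin n)).IsRegularOfDegree (n - 1) ∧
    (∀ j : Fin n, adjEig (⊤ : SimpleGraph (Fin n)) j = if j.val = 0 then (n : ℝ) - 1 else -1) ∧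
    regularBound (⊤ : SimpleGraph (Fin n)) hn d (n - 1) = n * us ∧
    opinionField (⊤ : SimpleGraph (Fin n)) d 0 us = 0 ∧
    LinearMap.ker (Dx (opinionField (⊤ : SimpleGraph (Fin n)) d) 0 us).toLinearMap
      = Submodule.span ℝ {(WithLp.toLp 2 fun _ => 1 : E n)} ∧
    ∀ F : Frame (Dx (opinionField (⊤ : SimpleGraph (Fin n)) d) 0 us) 1 (n - 1),
      ∀ Rpar Rperp : ℝ,
        (F.WithinBounds (opinionField (⊤ : SimpleGraph (Fin n)) d) 0 us Rpar Rperp ↔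
          0 < Rpar ∧ Rpar < n * us ∧ 0 < Rperp) ∧
        (0 < Rpar ∧ Rpar < n * us ∧ 0 < Rperp →
          ∃ φ, F.IsImplicitMap (opinionField (⊤ : SimpleGraph (Fin n)) d) 0 us Rpar Rperp φ) := by
  have hn₁ : (0 : ℝ) < n - 1 := sub_pos.mpr (Nat.one_lt_cast.mpr hn)
  have hus_pos : 0 < us := hus ▸ div_pos hd hn₁
  have hd_eq : d = (n - 1) * us := by rw [hus, mul_div_cancel₀ _ hn₁.ne']
  have hradius : n * us = d + us := by rw [hd_eq]; ring
  have hker := ker_Dx_opinionField_top_zero hus_pos.ne' hd_eq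
  have hJ := isSelfAdjoint_Dx_opinionField_zero (⊤ : SimpleGraph (Fin n)) d us
  have : NeZero (n - 1) := ⟨by omega⟩
  refine ⟨by simpa using SimpleGraph.IsRegularOfDegree.top (V := Fin n), adjEig_top,
    hus ▸ regularBound_top hn d, opinionField_zero _ d us, hker, fun F Rpar Rperp => ⟨?_, ?_⟩⟩
  · rw [hradius]
    exact F.withinBounds_opinionField_top_iff hJ hker hd hus_pos.le Rpar Rperp
  · rw [hradius]
    rintro ⟨-, hpar, hperp⟩
    exact ⟨0, F.isImplicitMap_zero_opinionField_top hJ hker hd.le hpar.le hperp⟩
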